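/- Let $a>0$ and let $C_n^{(a)}$, $n=0,1,2,\dots$, be the monic Charlier polynomials, defined by $C_{-1}^{(a)}=0$, $C_0^{(a)}=1$ and $$xC_n^{(a)}(x)=C_{n+1}^{(a)}(x)+(n+a)C_n^{(a)}(x)+an\,C_{n-1}^{(a)}(x),\qquad n=0,1,2,\dots$$ For every $n$ the polynomial $C_n^{(a)}$ has exactly $n$ distinct complex zeros, and all of them are real; write them as $x_{1,n}<x_{2,n}<\cdots<x_{n,n}$. Then for each fixed $k\in\{1,2,3,\dots\}$, $$x_{k,n}=k-1+\varepsilon_{k,n},\qquad n\to\infty,$$ where $\varepsilon_{k,n}$ is exponentially small, at every exponential rate: for every $c>0$, $\varepsilon_{k,n}=O(e^{-cn})$ as $n\to\infty$, where the implied constant may depend on $a$, $k$ and $c$. -/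

import Mathlib

open Polynomial

/-- The monic Charlier polynomials `C_n^{(a)}`, given by the three-term recurrence
`x C_n = C_{n+1} + (n + a) C_n + a n C_{n-1}` with `C_{-1} = 0` and `C_0 = 1`. -/
noncomputable def charlier (a : ℝ) : ℕ → ℝ[X]
  | 0 => 1
  | 1 => X - C a
  | n + 2 => (X - C (((n + 1 : ℕ) : ℝ) + a)) * charlier a (n + 1)
      - C (a * ((n + 1 : ℕ) : ℝ)) * charlier a n

/-- `x 1 < x 2 < ⋯ < x n` is the list of all the complex zeros of `C_n^{(a)}`
(in particular, these zeros are real and there are exactly `n` distinct ones).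
The values of `x` outside `{1, …, n}` are irrelevant. -/
def IsZeroEnumeration (a : ℝ) (n : ℕ) (x : ℕ → ℝ) : Prop :=
  StrictMonoOn x (Set.Icc 1 n) ∧
    (fun k : ℕ => (x k : ℂ)) '' Set.Icc 1 n = {z : ℂ | aeval z (charlier a n) = 0}

/-! Evaluate `C_n` at an integer `m`. By the difference relation `|C_n(m)| ≤ (a + m)^n`, while
`C_n(m)` is also the product of the `m - x_i`. The zeros are positive and more than one apart, so
those after the `(m+1)`-st exceed `m` by more than `1, 2, …, n - m - 1` and contribute at least `(n
- m - 1)!`. By strong induction the first `m` zeros tend to `0, …, m - 1`, so each eventually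
contributes at least `1/2`. The remaining factor `|m - x_{m+1}|` is thus at most `2^m (a + m)^n / (n
- m - 1)!`, smaller than any exponential (`abs_sub_le`). The spacing (`exists_zeros`) comes from the
raising relation. -/

/-- A monic polynomial of degree `N` with `N` distinct known roots is the product of the
corresponding linear factors. -/
theorem monic_eq_prod_X_sub_C {p : ℝ[X]} (hp : p.Monic) {N : ℕ} (hN : p.natDegree = N)
    {y : ℕ → ℝ} (hy : Set.InjOn y (Finset.range N)) (hr : ∀ i < N, p.eval (y i) = 0) :
    p = ∏ i ∈ Finset.range N, (X - C (y i)) := by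
  have hdvd : ∏ i ∈ Finset.range N, (X - C (y i)) ∣ p := by
    refine Finset.prod_dvd_of_coprime ?_ ?_
    · intro i hi j hj hij
      exact isCoprime_X_sub_C_of_isUnit_sub
        (sub_ne_zero.2 fun h => hij (hy hi hj h)).isUnit
    · intro i hi
      exact dvd_iff_isRoot.2 (hr i (Finset.mem_range.1 hi))
  refine eq_of_monic_of_dvd_of_natDegree_le (monic_prod_of_monic _ _ fun i _ => monic_X_sub_C _)
    hp hdvd ?_
  rw [natDegree_prod_of_monic _ _ fun i _ => monic_X_sub_C _]
  simp [hN]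

/-- The sign of `∏ (t - y j)` when exactly the first `i` of the `n` zeros are less than `t`. -/
theorem neg_one_pow_mul_prod_sub_pos {n i : ℕ} (hi : i ≤ n) {y : ℕ → ℝ} {t : ℝ}
    (hlt : ∀ j < i, y j < t) (hgt : ∀ j, i ≤ j → j < n → t < y j) :
    0 < (-1 : ℝ) ^ (n - i) * ∏ j ∈ Finset.range n, (t - y j) := by
  obtain ⟨l, rfl⟩ := Nat.exists_eq_add_of_le hi
  have h : (-1 : ℝ) ^ l * ∏ j ∈ Finset.range l, (t - y (i + j))
      = ∏ j ∈ Finset.range l, (y (i + j) - t) := by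
    calc _ = (∏ j ∈ Finset.range l, (-1 : ℝ)) * ∏ j ∈ Finset.range l, (t - y (i + j)) := by simp
      _ = _ := by
        rw [← Finset.prod_mul_distrib]
        exact Finset.prod_congr rfl fun j _ => by ring
  rw [Finset.prod_range_add, Nat.add_sub_cancel_left, mul_left_comm, h]
  refine mul_pos (Finset.prod_pos fun j hj => sub_pos.2 (hlt j (Finset.mem_range.1 hj)))
    (Finset.prod_pos fun j hj => sub_pos.2 (hgt _ (by omega) ?_))
  have := Finset.mem_range.1 hj
  omega

/-! ### Recurrences, values at integers, and spacing of the zeros -/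

namespace charlier

variable (a : ℝ)

theorem monic_and_natDegree (n : ℕ) :
    (charlier a n).Monic ∧ (charlier a n).natDegree = n := by
  induction n using Nat.twoStepInduction with
  | zero => simp [charlier]
  | one => simp [charlier, monic_X_sub_C]
  | more n h0 h1 =>
    rw [charlier]
    have hm := (monic_X_sub_C (((n + 1 : ℕ) : ℝ) + a)).mul h1.1
    have hd : ((X - C (((n + 1 : ℕ) : ℝ) + a)) * charlier a (n + 1)).natDegree = n + 2 := by
      rw [(monic_X_sub_C _).natDegree_mul h1.1, h1.2, natDegree_X_sub_C]
      omega
    have hlt : (C (a * ((n + 1 : ℕ) : ℝ)) * charlier a n).degree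
        < ((X - C (((n + 1 : ℕ) : ℝ) + a)) * charlier a (n + 1)).degree := by
      refine degree_lt_degree ?_
      rw [hd]
      refine lt_of_le_of_lt (natDegree_C_mul_le _ _) ?_
      omega
    refine ⟨hm.sub_of_left hlt, ?_⟩
    rw [natDegree_sub_eq_left_of_natDegree_lt, hd]
    rw [hd]
    refine lt_of_le_of_lt (natDegree_C_mul_le _ _) ?_
    omega

theorem eval_add_two (n : ℕ) (t : ℝ) :
    (charlier a (n + 2)).eval t
      = (t - (n + 1) - a) * (charlier a (n + 1)).eval t - a * (n + 1) * (charlier a n).eval t := by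
  rw [charlier]
  simp only [eval_sub, eval_mul, eval_X, eval_C]
  push_cast
  ring

/-- The forward difference relation. -/
theorem eval_add_one (n : ℕ) (t : ℝ) :
    (charlier a (n + 1)).eval (t + 1)
      = (charlier a (n + 1)).eval t + (n + 1) * (charlier a n).eval t := by
  induction n using Nat.twoStepInduction with
  | zero => simp [charlier]; ring
  | one => simp [charlier]; ring
  | more n h0 h1 =>
    rw [eval_add_two a (n + 1) (t + 1), h1, h0, eval_add_two a (n + 1) t]
    have h := eval_add_two a n t
    push_cast at h ⊢
    linear_combination (-(n : ℝ) - 2) * h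

/-- The raising relation `C_{n+1}(t) = t C_n(t - 1) - a C_n(t)`. -/
theorem eval_succ (n : ℕ) (t : ℝ) :
    (charlier a (n + 1)).eval t
      = t * (charlier a n).eval (t - 1) - a * (charlier a n).eval t := by
  cases n with
  | zero => simp [charlier]
  | succ n =>
    obtain ⟨s, rfl⟩ : ∃ s, t = s + 1 := ⟨t - 1, by ring⟩
    rw [add_sub_cancel_right, eval_add_one a (n + 1) s, eval_add_one a n s, eval_add_two]
    push_cast
    ring

variable {a}

theorem abs_eval_natCast_le (ha : 0 < a) (m n : ℕ) :
    |(charlier a n).eval (m : ℝ)| ≤ (a + m) ^ n := by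
  induction m generalizing n with
  | zero =>
    induction n with
    | zero => simp [charlier]
    | succ n ih =>
      simp only [Nat.cast_zero, add_zero] at ih ⊢
      rw [eval_succ, zero_mul, zero_sub, abs_neg, abs_mul, abs_of_pos ha, pow_succ']
      gcongr
  | succ m ih =>
    cases n with
    | zero => simp [charlier]
    | succ n =>
      -- The first two terms of the binomial expansion, matching the difference relation.
      have key : ∀ s : ℝ, 0 ≤ s → s ^ (n + 1) + (n + 1) * s ^ n ≤ (s + 1) ^ (n + 1) := by
        intro s hs
        clear ih
        induction n with
        | zero => simp
        | succ n ihn =>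
          rw [pow_succ (s + 1)]
          have h := mul_le_mul_of_nonneg_right ihn (by linarith : 0 ≤ s + 1)
          refine le_trans ?_ h
          have : 0 ≤ ((n : ℝ) + 1) * s ^ n := by positivity
          push_cast
          rw [pow_succ s (n + 1), pow_succ s n]
          nlinarith
      push_cast
      rw [eval_add_one]
      refine (abs_add_le _ _).trans ?_
      rw [abs_mul, abs_of_nonneg (by positivity : (0 : ℝ) ≤ n + 1), ← add_assoc]
      refine le_trans ?_ (key (a + m) (by positivity))
      gcongr
      · exact ih _
      · exact ih _

/-- The zeros of the Charlier polynomials are real, positive and more than one apart. -/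
theorem exists_zeros (ha : 0 < a) (n : ℕ) :
    ∃ y : ℕ → ℝ, (∀ i < n, 0 < y i) ∧ (∀ i j, i < j → j < n → y i + 1 < y j) ∧
      charlier a n = ∏ i ∈ Finset.range n, (X - C (y i)) := by
  induction n with
  | zero => exact ⟨fun _ => 0, by simp, by simp, by simp [charlier]⟩
  | succ n ih =>
    obtain ⟨y, hpos, hgap, hprod⟩ := ih
    have hev : ∀ t, (charlier a n).eval t = ∏ i ∈ Finset.range n, (t - y i) := by
      intro t
      rw [hprod, eval_prod]
      simp
    have hmono : ∀ i j, i ≤ j → j < n → y i ≤ y j := by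
      intro i j hij hj
      rcases hij.eq_or_lt with rfl | h
      · exact le_rfl
      · linarith [hgap i j h hj]
    have hroot : ∀ i < n, (charlier a n).eval (y i) = 0 := fun i hi => by
      rw [hev]
      exact Finset.prod_eq_zero (Finset.mem_range.2 hi) (sub_self _)
    have hdeg := monic_and_natDegree a (n + 1)
    have hcont : Continuous fun t => (charlier a (n + 1)).eval t := (charlier a (n + 1)).continuous
    -- The witness is `0` or `y (i - 1) + 1`: there the term `t C_n(t - 1)` of the raising relation
    -- vanishes, leaving `-a C_n(t)`.
    have left : ∀ i ≤ n, ∃ w : ℝ, 0 ≤ w ∧ (∀ j < i, y j + 1 ≤ w) ∧ (i < n → w < y i) ∧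
        (-1) ^ (n - i) * (charlier a (n + 1)).eval w < 0 := by
      intro i hi
      have main : ∀ w : ℝ, (∀ j < i, y j + 1 ≤ w) → (i < n → w < y i) →
          w * (charlier a n).eval (w - 1) = 0 →
          (-1) ^ (n - i) * (charlier a (n + 1)).eval w < 0 := by
        intro w h1 h2 h3
        have hs := neg_one_pow_mul_prod_sub_pos hi (fun j hj => by linarith [h1 j hj])
          (fun j hij hj => lt_of_lt_of_le (h2 (by omega)) (hmono i j hij hj)) (t := w)
        rw [← hev] at hs
        rw [eval_succ, h3]
        nlinarith [mul_pos ha hs]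
      cases i with
      | zero =>
        exact ⟨0, le_rfl, by simp, fun h => hpos 0 h, main 0 (by simp) (hpos 0) (by simp)⟩
      | succ i =>
        have h1 : ∀ j < i + 1, y j + 1 ≤ y i + 1 := fun j hj => by
          linarith [hmono j i (by omega) (by omega)]
        have h2 : i + 1 < n → y i + 1 < y (i + 1) := hgap i (i + 1) (by omega)
        refine ⟨y i + 1, by linarith [hpos i (by omega)], h1, h2, main _ h1 h2 ?_⟩
        rw [add_sub_cancel_right, hroot i (by omega), mul_zero]
    have right : ∀ i ≤ n, ∀ w : ℝ, (i < n → w < y i) →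
        ∃ r, w < r ∧ (i < n → r ≤ y i) ∧ 0 < (-1) ^ (n - i) * (charlier a (n + 1)).eval r := by
      intro i hi w hw
      -- Past the last zero the leading coefficient gives the sign. Otherwise, at `y i`, only `t
      -- C_n(t - 1)` survives, and the gap puts exactly `i` zeros below `y i - 1`.
      rcases hi.eq_or_lt with rfl | hi
      · have ht : Filter.Tendsto (fun t => (charlier a (i + 1)).eval t)
            Filter.atTop Filter.atTop := by
          refine tendsto_atTop_of_leadingCoeff_nonneg _ ?_ ?_
          · rw [degree_eq_natDegree hdeg.1.ne_zero, hdeg.2]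
            exact_mod_cast Nat.succ_pos i
          · rw [hdeg.1.leadingCoeff]
            exact zero_le_one
        obtain ⟨r, hr1, hr2⟩ := ((Filter.eventually_gt_atTop w).and
          (ht.eventually_gt_atTop 0)).exists
        exact ⟨r, hr1, by simp, by simpa using hr2⟩
      · refine ⟨y i, hw hi, fun _ => le_rfl, ?_⟩
        have hs := neg_one_pow_mul_prod_sub_pos hi.le (y := y) (t := y i - 1)
          (fun j hj => by linarith [hgap j i hj hi])
          (fun j hij hj => by linarith [hmono i j hij hj])
        rw [← hev] at hs
        rw [eval_succ, hroot i hi, mul_zero, sub_zero, mul_left_comm]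
        exact mul_pos (hpos i hi) hs
    have zero : ∀ i, ∃ z : ℝ, i ≤ n → 0 < z ∧ (∀ j < i, y j + 1 < z) ∧ (i < n → z < y i) ∧
        (charlier a (n + 1)).eval z = 0 := by
      intro i
      by_cases hi : i ≤ n
      swap
      · exact ⟨0, fun h => absurd h hi⟩
      obtain ⟨w, hw0, hw1, hw2, hw3⟩ := left i hi
      obtain ⟨r, hr1, hr2, hr3⟩ := right i hi w hw2
      have hc : Continuous fun t => (-1) ^ (n - i) * (charlier a (n + 1)).eval t :=
        hcont.const_mul _
      obtain ⟨z, hz, hz0⟩ := intermediate_value_Ioo hr1.le hc.continuousOn ⟨hw3, hr3⟩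
      refine ⟨z, fun _ => ⟨hw0.trans_lt hz.1, fun j hj => (hw1 j hj).trans_lt hz.1,
        fun h => hz.2.trans_le (hr2 h), ?_⟩⟩
      simpa using hz0
    choose z hz using zero
    -- Interlacing: `z i < y i` and `y i + 1 < z j`.
    have hzgap : ∀ i j, i < j → j < n + 1 → z i + 1 < z j := fun i j hij hj => by
      have h1 := (hz i (by omega)).2.2.1 (by omega)
      have h2 := (hz j (by omega)).2.1 i hij
      linarith
    refine ⟨z, fun i hi => (hz i (by omega)).1, hzgap, ?_⟩
    refine monic_eq_prod_X_sub_C hdeg.1 hdeg.2 ?_ fun i hi => (hz i (by omega)).2.2.2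
    intro i hi j hj hij
    simp only [Finset.coe_range, Set.mem_Iio] at hi hj
    rcases lt_trichotomy i j with h | h | h
    · linarith [hzgap i j h hj]
    · exact h
    · linarith [hzgap j i h hi]

end charlier

theorem exists_isZeroEnumeration {a : ℝ} (ha : 0 < a) (n : ℕ) :
    ∃ x : ℕ → ℝ, IsZeroEnumeration a n x := by
  obtain ⟨y, -, hgap, hprod⟩ := charlier.exists_zeros ha n
  refine ⟨fun k => y (k - 1), ?_, ?_⟩
  · intro i hi j hj hij
    simp only [Set.mem_Icc] at hi hj
    have := hgap (i - 1) (j - 1) (by omega) (by omega)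
    simp only
    linarith
  · ext z
    simp only [hprod, map_prod, map_sub, aeval_X, aeval_C, Finset.prod_eq_zero_iff,
      Finset.mem_range, Set.mem_image, Set.mem_Icc, Set.mem_ofPred_eq, sub_eq_zero,
      Complex.coe_algebraMap]
    constructor
    · rintro ⟨k, hk, rfl⟩
      exact ⟨k - 1, by omega, rfl⟩
    · rintro ⟨i, hi, rfl⟩
      exact ⟨i + 1, by omega, by simp⟩

/-! ### Transfer to an arbitrary enumeration, and the estimate -/

namespace IsZeroEnumeration

variable {a : ℝ} {n : ℕ} {x : ℕ → ℝ}

theorem eval_eq_zero (h : IsZeroEnumeration a n x) {i : ℕ} (hi : i < n) :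
    (charlier a n).eval (x (i + 1)) = 0 := by
  have hz : ((x (i + 1) : ℝ) : ℂ) ∈ {z : ℂ | aeval z (charlier a n) = 0} :=
    h.2 ▸ ⟨i + 1, ⟨by omega, by omega⟩, rfl⟩
  have h1 : aeval (algebraMap ℝ ℂ (x (i + 1))) (charlier a n) = 0 := hz
  rw [aeval_algebraMap_apply] at h1
  have h2 : aeval (x (i + 1)) (charlier a n) = 0 := by
    simpa using h1
  simpa [coe_aeval_eq_eval] using h2

theorem lt (h : IsZeroEnumeration a n x) {i j : ℕ} (hij : i < j) (hj : j < n) :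
    x (i + 1) < x (j + 1) :=
  h.1 ⟨by omega, by omega⟩ ⟨by omega, by omega⟩ (by omega)

theorem eval_eq_prod (h : IsZeroEnumeration a n x) (t : ℝ) :
    (charlier a n).eval t = ∏ i ∈ Finset.range n, (t - x (i + 1)) := by
  have hdeg := charlier.monic_and_natDegree a n
  rw [monic_eq_prod_X_sub_C hdeg.1 hdeg.2 (y := fun i => x (i + 1)) ?_
    fun i hi => h.eval_eq_zero hi, eval_prod]
  · simp
  · intro i hi j hj hij
    simp only [Finset.coe_range, Set.mem_Iio] at hi hj hij
    rcases lt_trichotomy i j with hlt | heq | hlt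
    · exact absurd hij (h.lt hlt hj).ne
    · exact heq
    · exact absurd hij (h.lt hlt hi).ne'

/-- The first zero is positive and each further one adds more than `1`. -/
theorem natCast_lt (ha : 0 < a) (h : IsZeroEnumeration a n x) {i : ℕ} (hi : i < n) :
    (i : ℝ) < x (i + 1) := by
  obtain ⟨y, hpos, hgap, hprod⟩ := charlier.exists_zeros ha n
  have hmem : ∀ i < n, ∃ j < n, x (i + 1) = y j := by
    intro i hi
    have h0 := h.eval_eq_zero hi
    rw [hprod, eval_prod, Finset.prod_eq_zero_iff] at h0
    obtain ⟨j, hj, h0⟩ := h0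
    refine ⟨j, Finset.mem_range.1 hj, ?_⟩
    simpa [sub_eq_zero] using h0
  induction i with
  | zero =>
    obtain ⟨j, hj, he⟩ := hmem 0 hi
    rw [he]
    exact_mod_cast hpos j hj
  | succ i ih =>
    have hlt := h.lt (Nat.lt_succ_self i) hi
    have ih := ih (by omega)
    obtain ⟨j, hj, he⟩ := hmem i (by omega)
    obtain ⟨k, hk, he'⟩ := hmem (i + 1) hi
    rw [he] at ih
    rw [Nat.succ_eq_add_one, he, he'] at hlt
    rw [he']
    push_cast
    rcases lt_trichotomy j k with hjk | rfl | hjk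
    · linarith [hgap j k hjk hk]
    · exact absurd hlt (lt_irrefl _)
    · linarith [hgap k j hjk hj]

/-- If the first `m` zeros are at distance at least `1 / 2` from `m`, then the next one is close
to `m`. -/
theorem abs_sub_le {m l : ℕ} (ha : 0 < a) (h : IsZeroEnumeration a (m + 1 + l) x)
    (hm : ∀ i < m, 1 / 2 ≤ |(m : ℝ) - x (i + 1)|) :
    |x (m + 1) - m| ≤ 2 ^ m * ((a + m) ^ (m + 1 + l) / l.factorial) := by
  have hle := charlier.abs_eval_natCast_le ha m (m + 1 + l)
  rw [h.eval_eq_prod, Finset.abs_prod, Finset.prod_range_add, Finset.prod_range_succ,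
    abs_sub_comm (m : ℝ) (x (m + 1))] at hle
  have h1 : (1 / 2 : ℝ) ^ m ≤ ∏ i ∈ Finset.range m, |(m : ℝ) - x (i + 1)| := by
    calc (1 / 2 : ℝ) ^ m = ∏ i ∈ Finset.range m, (1 / 2 : ℝ) := by simp
      _ ≤ _ := Finset.prod_le_prod (fun _ _ => by norm_num)
        fun i hi => hm i (Finset.mem_range.1 hi)
  have h2 : (l.factorial : ℝ) ≤ ∏ i ∈ Finset.range l, |(m : ℝ) - x (m + 1 + i + 1)| := by
    rw [← Finset.prod_range_add_one_eq_factorial]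
    push_cast
    refine Finset.prod_le_prod (fun _ _ => by positivity) fun i hi => ?_
    have hx := h.natCast_lt ha (i := m + 1 + i) (by have := Finset.mem_range.1 hi; omega)
    rw [abs_sub_comm]
    refine le_trans ?_ (le_abs_self _)
    push_cast at hx
    linarith
  have hfac : (0 : ℝ) < l.factorial := by exact_mod_cast l.factorial_pos
  have h3 : (1 / 2 : ℝ) ^ m * |x (m + 1) - m| * l.factorial ≤ (a + m) ^ (m + 1 + l) := by
    refine le_trans ?_ hle
    gcongr
  rw [← mul_div_assoc, le_div_iff₀ hfac]
  calc |x (m + 1) - m| * l.factorial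
      = 2 ^ m * ((1 / 2 : ℝ) ^ m * |x (m + 1) - m| * l.factorial) := by
        rw [← mul_assoc, ← mul_assoc, ← mul_pow]
        norm_num
    _ ≤ _ := by gcongr

end IsZeroEnumeration

theorem isBigO_zero_sub {a : ℝ} (ha : 0 < a) {x : ℕ → ℕ → ℝ}
    (hx : ∀ n, IsZeroEnumeration a n (x n)) (m : ℕ) {c : ℝ} (hc : 0 < c) :
    (fun n : ℕ => x n (m + 1) - m) =O[Filter.atTop] fun n : ℕ => Real.exp (-c * n) := by
  induction m using Nat.strong_induction_on with
  | _ m ih =>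
    have hexp : Filter.Tendsto (fun n : ℕ => Real.exp (-c * n)) Filter.atTop (nhds 0) := by
      refine Real.tendsto_exp_atBot.comp ?_
      exact tendsto_natCast_atTop_atTop.const_mul_atTop_of_neg (by linarith)
    have hsep : ∀ᶠ n in Filter.atTop, ∀ i ∈ Finset.range m,
        1 / 2 ≤ |(m : ℝ) - x n (i + 1)| := by
      rw [Filter.eventually_all_finset]
      intro i hi
      have him := Finset.mem_range.1 hi
      have ht := (ih i him).trans_tendsto hexp
      filter_upwards [ht.eventually_lt_const (by norm_num : (0 : ℝ) < 1 / 2)] with n hn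
      have : (i : ℝ) + 1 ≤ m := by exact_mod_cast him
      refine le_trans ?_ (le_abs_self _)
      linarith
    -- The rate `e^c` is absorbed into the base; the factorial still wins, so the constant is
    -- uniform in `l`.
    obtain ⟨K, hK⟩ := (FloorSemiring.tendsto_pow_div_factorial_atTop
      ((a + m) * Real.exp c)).bddAbove_range
    refine Asymptotics.IsBigO.of_bound (2 ^ m * ((a + m) * Real.exp c) ^ (m + 1) * K) ?_
    filter_upwards [hsep, Filter.eventually_ge_atTop (m + 1)] with n hn hmn
    obtain ⟨l, rfl⟩ := Nat.exists_eq_add_of_le hmn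
    have hl : ((a + m) * Real.exp c) ^ l / l.factorial ≤ K := hK ⟨l, rfl⟩
    have hb := (hx (m + 1 + l)).abs_sub_le ha fun i hi => hn i (Finset.mem_range.2 hi)
    rw [Real.norm_eq_abs, Real.norm_eq_abs, Real.abs_exp]
    have he : Real.exp c ^ (m + 1 + l) * Real.exp (-c * (m + 1 + l : ℕ)) = 1 := by
      rw [← Real.exp_nat_mul, ← Real.exp_add, ← Real.exp_zero]
      congr 1
      ring
    calc |x (m + 1 + l) (m + 1) - m|
        ≤ 2 ^ m * ((a + m) ^ (m + 1 + l) / l.factorial) := hb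
      _ = 2 ^ m * ((a + m) ^ (m + 1 + l) / l.factorial)
          * (Real.exp c ^ (m + 1 + l) * Real.exp (-c * (m + 1 + l : ℕ))) := by
        rw [he, mul_one]
      _ = 2 ^ m * ((a + m) * Real.exp c) ^ (m + 1)
          * (((a + m) * Real.exp c) ^ l / l.factorial) * Real.exp (-c * (m + 1 + l : ℕ)) := by
        rw [pow_add (Real.exp c), pow_add (a + m) (m + 1) l, mul_pow, mul_pow]
        ring
      _ ≤ _ := by gcongr

theorem mainTheorem4 (a : ℝ) (ha : 0 < a) :
    (∀ n : ℕ, ∃ x : ℕ → ℝ, IsZeroEnumeration a n x) ∧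
    ∀ x : ℕ → ℕ → ℝ, (∀ n : ℕ, IsZeroEnumeration a n (x n)) →
      ∀ k : ℕ, 1 ≤ k → ∀ c : ℝ, 0 < c →
        (fun n : ℕ => x n k - ((k : ℝ) - 1)) =O[Filter.atTop]
          (fun n : ℕ => Real.exp (-c * (n : ℝ))) := by
  refine ⟨exists_isZeroEnumeration ha, fun x hx k hk c hc => ?_⟩
  obtain ⟨m, rfl⟩ := Nat.exists_eq_add_of_le' hk
  simpa using isBigO_zero_sub ha hx m hc
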